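/- For a finite simple graph $G=(V,E)$, let $M(G)$ be the family of matchings of $G$, i.e. of those sets of edges $J\subseteq E$ whose members are pairwise disjoint. Let $\mu(G)$ be the minimum number $m$ such that $M(G)$ is the intersection of (the families of independent sets of) $m$ matroids on the ground set $E$, and let $\mu(n)=\max\{\mu(G): G=(V,E)\text{ a finite simple graph with } |V|\le n\}$. Then $\mu(n)=5$ for $n=13,14,15$. -/

import Mathlib

/-- The family `I` of subsets of `E` is the intersection of `m` matroids on the ground set `E`
(for `m = 0` the intersection is the family of all subsets of `E`). -/
def IsMatroidIntersection {α : Type*} (E : Set α) (I : Set (Set α)) (m : ℕ) : Prop :=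
  ∃ M : Fin m → Matroid α,
    (∀ a, (M a).E = E) ∧ I = {J : Set α | J ⊆ E ∧ ∀ a, (M a).Indep J}

/-- The matchings `M(G)` of a graph: the sets of edges of `G` that are pairwise disjoint. -/
def matchings {V : Type*} (G : SimpleGraph V) : Set (Set (Sym2 V)) :=
  {J | J ⊆ G.edgeSet ∧ ∀ e ∈ J, ∀ f ∈ J, e ≠ f → ∀ v, v ∈ e → v ∉ f}

/-- `μ(G)`: the minimum number of matroids on the edge set of `G` whose intersection is `M(G)`.
It takes values in `ℕ∞`, so that the infimum of an empty set would be `⊤`, not a natural number. -/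
noncomputable def muGraph {V : Type*} (G : SimpleGraph V) : ℕ∞ :=
  ⨅ (m : ℕ) (_ : IsMatroidIntersection G.edgeSet (matchings G) m), (m : ℕ∞)

/-- `μ(n)`: the maximum of `μ(G)` over the finite graphs `G` with at most `n` vertices.
A supremum in `ℕ∞` that is a natural number is attained, so it is then a maximum. -/
noncomputable def mu (n : ℕ) : ℕ∞ :=
  sSup {k : ℕ∞ | ∃ (V : Type) (_ : Finite V) (G : SimpleGraph V),
    Nat.card V ≤ n ∧ k = muGraph G}

/-! Lower bound, on a complete graph. Matchings are independent in each matroid, so no edge is a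
loop and parallel edges meet: a parallel class is part of a star or is a triangle. Two incident
edges are not a matching, so some matroid makes them parallel. Four matroids thus give a
`StarTriangleCover`, and `card_lt_thirteen` allows it at most 12 vertices.

If every `S x y` has at least two colours, then `S x y` and `S y x` are complementary pairs, no
colour is left for triangles, and the sets `S x w` at a fixed `w` meet pairwise. So `w` sees at most
one half of each of the three splittings of the colours into pairs. This gives `w` a type of three
bits; two vertices differ at the splitting formed by their edge, so there are at most 8 vertices
(`exists_type_map`). A singleton `S y x = {i}` is repaired by a vertex `p i` whose triangles supply
a second colour; deleting the four vertices `p i` leaves at most 8, hence the bound 8 + 4. Such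
vertices exist (`exists_repairing_vertex`) unless two different singletons occur at one vertex. With
13 vertices that is impossible (`eq_of_singletons`): it would leave 8 vertices `w` with two common
colours in `S w v`, which `false_of_card_eight` refutes by the type argument with two bits.

Upper bound: there are five linear orders on 15 points such that each point lies above any two
others in one of them. Partitioning the edges by their upper ends gives five matroids. -/

/-- The pattern that four partitions of the edges of a complete graph into stars and triangles
leave on its vertices: `S u v` is the set of the partitions in which the class of the edge `uv` is
a star centred at `v`, and `tri c u v w` says that `uv`, `vw`, `uw` form a class of the
partition `c`. Every two incident edges lie in a common class of some partition. -/
structure StarTriangleCover (V : Type*) where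
  S : V → V → Finset (Fin 4)
  tri : Fin 4 → V → V → V → Prop
  disj : ∀ {c u v}, c ∈ S u v → c ∉ S v u
  tri_swap : ∀ {c u v w}, tri c u v w → tri c v u w
  tri_rot : ∀ {c u v w}, tri c u v w → tri c v w u
  tri_notMem : ∀ {c u v w}, tri c u v w → c ∉ S u v
  tri_unique : ∀ {c u v w w'}, tri c u v w → tri c u v w' → w = w'
  cover : ∀ {u v w}, u ≠ v → w ≠ v → u ≠ w → (∃ c, c ∈ S u v ∧ c ∈ S w v) ∨ ∃ c, tri c u v w

/-! ### Basic properties of covers -/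

namespace StarTriangleCover

variable {V : Type*} (C : StarTriangleCover V)

theorem tri_notMem' {c : Fin 4} {u v w : V} (h : C.tri c u v w) : c ∉ C.S v u :=
  C.tri_notMem (C.tri_swap h)

theorem tri_swap_right {c : Fin 4} {u v w : V} (h : C.tri c u v w) : C.tri c u w v :=
  C.tri_swap (C.tri_rot (C.tri_rot h))

/-- Permuting the four partitions. -/
def relabel (σ : Equiv.Perm (Fin 4)) : StarTriangleCover V where
  S u v := (C.S u v).map σ.toEmbedding
  tri c := C.tri (σ.symm c)
  disj := by
    intro c u v h h'
    rw [Finset.mem_map_equiv] at h h'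
    exact C.disj h h'
  tri_swap := fun h => C.tri_swap h
  tri_rot := fun h => C.tri_rot h
  tri_notMem := by
    intro c u v w h h'
    rw [Finset.mem_map_equiv] at h'
    exact C.tri_notMem h h'
  tri_unique := fun h h' => C.tri_unique h h'
  cover := by
    intro u v w h1 h2 h3
    rcases C.cover h1 h2 h3 with ⟨c, hc, hc'⟩ | ⟨c, hc⟩
    · exact Or.inl ⟨σ c, by simpa using hc, by simpa using hc'⟩
    · exact Or.inr ⟨σ c, by simpa using hc⟩

/-- Few vertices form a triangle with a given edge. -/
theorem card_le_of_tri {u v : V} (s : Finset V) (t : Finset (Fin 4))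
    (h : ∀ w ∈ s, ∃ c ∈ t, C.tri c u v w) : s.card ≤ t.card := by
  choose! f hf using h
  refine Finset.card_le_card_of_injOn f (fun w hw => (hf w hw).1) ?_
  intro w hw w' hw' e
  have h1 := (hf w hw).2
  rw [e] at h1
  exact C.tri_unique h1 (hf w' hw').2

/-- Otherwise each of the at least five other vertices forms a triangle with `uv`, one for each
colour at most. -/
theorem S_nonempty [Fintype V] [DecidableEq V] (hV : 7 ≤ Fintype.card V) {u v : V} (huv : u ≠ v) :
    (C.S u v).Nonempty := by
  rw [Finset.nonempty_iff_ne_empty]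
  intro h
  have h1 := C.card_le_of_tri (u := u) (v := v) (Finset.univ \ {u, v}) Finset.univ (by
    intro w hw
    simp only [Finset.mem_sdiff, Finset.mem_univ, Finset.mem_insert, Finset.mem_singleton,
      not_or, true_and] at hw
    rcases C.cover huv hw.2 (Ne.symm hw.1) with ⟨c, hc, -⟩ | ⟨c, hc⟩
    · simp [h] at hc
    · exact ⟨c, Finset.mem_univ _, hc⟩)
  have h2 := Finset.le_card_sdiff {u, v} (Finset.univ : Finset V)
  rw [Finset.card_pair huv, Finset.card_univ] at h2
  simp at h1
  omega

/-! ### Types of vertices -/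

/-- The two halves of the three splittings of a set of four colours into pairs. -/
def side (j : Fin 3) (b : Bool) : Finset (Fin 4) :=
  match j, b with
  | 0, true => {0, 1}
  | 0, false => {2, 3}
  | 1, true => {0, 2}
  | 1, false => {1, 3}
  | 2, true => {0, 3}
  | 2, false => {1, 2}

theorem exists_eq_side : ∀ s : Finset (Fin 4), s.card = 2 → ∃ j b, s = side j b := by decide

theorem side_compl : ∀ j b, (side j b)ᶜ = side j !b := by decide

open Classical in
/-- `S y x`, augmented if it is a singleton `{i}` by the colours of the triangles on `yx` with the
third vertex `p i`. -/
noncomputable def augment (p : Fin 4 → V) (y x : V) : Finset (Fin 4) :=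
  {c | c ∈ C.S y x ∨ ∃ i, C.S y x = {i} ∧ C.tri c (p i) y x}

/-- The augmented sets of the two directions of an edge are disjoint (`hpp` excludes that one
triangle repairs both) and have at least two colours each. So they are complementary and exhaust the
colours of the edge, which excludes triangles inside `U`. By `cover`, no two augmented sets at one
vertex are then complementary. -/
theorem exists_type_map (U : Finset V) (p : Fin 4 → V) (hp : ∀ i, p i ∉ U)
    (hne : ∀ x ∈ U, ∀ y ∈ U, x ≠ y → (C.S x y).Nonempty)
    (htri : ∀ x ∈ U, ∀ y ∈ U, x ≠ y → ∀ i, C.S y x = {i} → ∃ c, C.tri c (p i) y x)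
    (hpp : ∀ x ∈ U, ∀ y ∈ U, x ≠ y → ∀ i k, C.S y x = {i} → C.S x y = {k} → p i ≠ p k) :
    ∃ τ : V → Fin 3 → Bool, ∀ x ∈ U, ∀ y ∈ U, x ≠ y →
      ∃ j, τ x j ≠ τ y j ∧ C.S x y ⊆ side j (τ y j) ∧ C.S y x ⊆ side j (τ x j) := by
  classical
  have hmem : ∀ {c y x}, c ∈ C.augment p y x ↔
      (c ∈ C.S y x ∨ ∃ i, C.S y x = {i} ∧ C.tri c (p i) y x) := by
    intro c y x; simp [augment]
  have hdisj : ∀ x ∈ U, ∀ y ∈ U, x ≠ y → Disjoint (C.augment p y x) (C.augment p x y) := by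
    intro x hx y hy hxy
    rw [Finset.disjoint_left]
    intro c h h'
    rw [hmem] at h h'
    rcases h with h | ⟨i, hi, h⟩ <;> rcases h' with h' | ⟨k, hk, h'⟩
    · exact C.disj h h'
    · exact C.tri_notMem' (C.tri_rot h') h
    · exact C.tri_notMem' (C.tri_rot h) h'
    · exact hpp x hx y hy hxy i k hi hk
        (C.tri_unique (C.tri_rot h) (C.tri_swap (C.tri_rot h')))
  have hcard : ∀ x ∈ U, ∀ y ∈ U, x ≠ y → 2 ≤ (C.augment p y x).card := by
    intro x hx y hy hxy
    have h0 : C.S y x ⊆ C.augment p y x := fun c hc => hmem.2 (Or.inl hc)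
    have h1 := (hne y hy x hx hxy.symm).card_pos
    by_cases h2 : (C.S y x).card = 1
    · obtain ⟨i, hi⟩ := Finset.card_eq_one.1 h2
      obtain ⟨c, hc⟩ := htri x hx y hy hxy i hi
      have h3 : c ∉ C.S y x := C.tri_notMem (C.tri_rot hc)
      have h4 : insert c (C.S y x) ⊆ C.augment p y x :=
        Finset.insert_subset (hmem.2 (Or.inr ⟨i, hi, hc⟩)) h0
      have := Finset.card_le_card h4
      rw [Finset.card_insert_of_notMem h3] at this
      omega
    · have := Finset.card_le_card h0
      omega
  have hcompl : ∀ x ∈ U, ∀ y ∈ U, x ≠ y →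
      (C.augment p y x).card = 2 ∧ C.augment p x y = (C.augment p y x)ᶜ := by
    intro x hx y hy hxy
    have h1 := hcard x hx y hy hxy
    have h2 := hcard y hy x hx hxy.symm
    have h3 := hdisj x hx y hy hxy
    have h4 := Finset.card_union_of_disjoint h3
    have h5 := Finset.card_le_univ (C.augment p y x ∪ C.augment p x y)
    simp only [Fintype.card_fin] at h5
    refine ⟨by omega, ?_⟩
    apply Finset.eq_of_subset_of_card_le
    · exact Finset.subset_compl_iff_disjoint_left.2 h3
    · rw [Finset.card_compl, Fintype.card_fin]; omega
  have hno : ∀ x ∈ U, ∀ y ∈ U, x ≠ y → ∀ w ∈ U, ∀ c, ¬ C.tri c x y w := by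
    intro x hx y hy hxy w hw c hc
    have h1 := (hcompl x hx y hy hxy).2
    by_cases h2 : c ∈ C.augment p y x
    · rcases hmem.1 h2 with h | ⟨i, hi, h⟩
      · exact C.tri_notMem' hc h
      · exact hp i (C.tri_unique (C.tri_rot h) (C.tri_swap hc) ▸ hw)
    · have h3 : c ∈ C.augment p x y := by rw [h1]; simpa using h2
      rcases hmem.1 h3 with h | ⟨i, hi, h⟩
      · exact C.tri_notMem hc h
      · exact hp i (C.tri_unique (C.tri_rot h) hc ▸ hw)
  have hint : ∀ x ∈ U, ∀ y ∈ U, ∀ w ∈ U, x ≠ w → y ≠ w →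
      C.augment p x w ≠ (C.augment p y w)ᶜ := by
    intro x hx y hy w hw hxw hyw h
    by_cases hxy : x = y
    · subst hxy
      obtain ⟨c, hc⟩ := hne x hx w hw hxw
      have hc' : c ∈ C.augment p x w := hmem.2 (Or.inl hc)
      have h2 := hc'
      rw [h] at h2
      exact (Finset.mem_compl.1 h2) hc'
    rcases C.cover hxw hyw hxy with ⟨c, hc, hc'⟩ | ⟨c, hc⟩
    · have h1 : c ∈ C.augment p x w := hmem.2 (Or.inl hc)
      rw [h] at h1
      exact (Finset.mem_compl.1 h1) (hmem.2 (Or.inl hc'))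
    · exact hno x hx w hw hxw y hy c hc
  -- The bit is also `false` if `w` sees neither half; it matters only that `w` never sees both.
  refine ⟨fun w j => decide (∃ x ∈ U, x ≠ w ∧ C.augment p x w = side j true), ?_⟩
  intro x hx y hy hxy
  have hsub : C.S x y ⊆ C.augment p x y := fun c hc => hmem.2 (Or.inl hc)
  have hsub' : C.S y x ⊆ C.augment p y x := fun c hc => hmem.2 (Or.inl hc)
  obtain ⟨h2, h3⟩ := hcompl y hy x hx hxy.symm
  obtain ⟨j, b, hj⟩ := exists_eq_side _ h2
  rw [hj, side_compl] at h3
  refine ⟨j, ?_⟩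
  cases b with
  | true =>
    have hy' : ∃ z ∈ U, z ≠ y ∧ C.augment p z y = side j true := ⟨x, hx, hxy, hj⟩
    have hx' : ¬ ∃ z ∈ U, z ≠ x ∧ C.augment p z x = side j true := by
      rintro ⟨z, hz, hzx, hz'⟩
      refine hint z hz y hy x hx hzx hxy.symm ?_
      rw [hz', h3, side_compl]; rfl
    simp only [hx', hy', decide_true, decide_false]
    exact ⟨by simp, hj ▸ hsub, h3 ▸ hsub'⟩
  | false =>
    have hx' : ∃ z ∈ U, z ≠ x ∧ C.augment p z x = side j true := ⟨y, hy, hxy.symm, h3⟩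
    have hy' : ¬ ∃ z ∈ U, z ≠ y ∧ C.augment p z y = side j true := by
      rintro ⟨z, hz, hzx, hz'⟩
      refine hint z hz x hx y hy hzx hxy ?_
      rw [hz', hj, side_compl]; rfl
    simp only [hx', hy', decide_true, decide_false]
    exact ⟨by simp, hj ▸ hsub, h3 ▸ hsub'⟩

/-! ### Repairing vertices -/

/-- Without two different singletons at a vertex, every colour `i` has a vertex `r` that forms a
triangle with every edge `yx` for which `S y x = {i}`. -/
theorem exists_repairing_vertex (U : Finset V) (hU : U.Nonempty)
    (hne : ∀ x ∈ U, ∀ y ∈ U, x ≠ y → (C.S x y).Nonempty)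
    (hsing : ∀ v ∈ U, ∀ x ∈ U, ∀ y ∈ U, x ≠ v → y ≠ v → ∀ i k, C.S x v = {i} → C.S y v = {k} →
      i = k) (i : Fin 4) :
    ∃ r ∈ U, ((∃ x ∈ U, x ≠ r ∧ C.S x r = {i}) ∨ ∀ x ∈ U, ∀ y ∈ U, x ≠ y → C.S y x ≠ {i}) ∧
      ∀ x ∈ U, ∀ y ∈ U, x ≠ r → y ≠ r → x ≠ y → C.S y x = {i} → ∃ c, C.tri c r y x := by
  by_cases hZ : ∀ x ∈ U, ∀ y ∈ U, x ≠ y → C.S y x ≠ {i}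
  · obtain ⟨r, hr⟩ := hU
    exact ⟨r, hr, Or.inr hZ, fun x hx y hy _ _ hxy h => absurd h (hZ x hx y hy hxy)⟩
  push Not at hZ
  obtain ⟨v, hv, u, hu, hvu, huv⟩ := hZ
  by_contra hcon
  push Not at hcon
  have bad : ∀ r ∈ U, ∀ z ∈ U, z ≠ r → C.S z r = {i} → ∃ x ∈ U, ∃ y ∈ U, x ≠ r ∧ y ≠ r ∧ x ≠ y ∧
      C.S y x = {i} ∧ ∀ c, ¬ C.tri c r y x :=
    fun r hr z hz hzr h => hcon r hr (Or.inl ⟨z, hz, hzr, h⟩)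
  -- the shape of a second vertex with a singleton `{i}`
  have key : ∀ v ∈ U, ∀ u ∈ U, u ≠ v → C.S u v = {i} → ∀ x ∈ U, ∀ y ∈ U, x ≠ v → y ≠ v → x ≠ y →
      C.S y x = {i} → (∀ c, ¬ C.tri c v y x) →
      C.S v x = {i} ∧ u ≠ x ∧ ∃ j, C.tri j u v x ∧ ∀ j' w, C.tri j' v x w → j' = j := by
    intro v hv u hu huv hS x hx y hy hxv hyv hxy hyx hno
    have h1 : i ∈ C.S v x := by
      rcases C.cover (Ne.symm hxv) (Ne.symm hxy) (Ne.symm hyv) with ⟨c, hc, hc'⟩ | ⟨c, hc⟩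
      · rw [hyx, Finset.mem_singleton] at hc'
        exact hc' ▸ hc
      · exact absurd (C.tri_swap_right hc) (hno c)
    have h2 : i ∉ C.S x v := C.disj h1
    have hux : u ≠ x := by
      rintro rfl
      rw [hS] at h2
      simp at h2
    obtain ⟨j, hj⟩ : ∃ j, C.tri j u v x := by
      rcases C.cover huv hxv hux with ⟨c, hc, hc'⟩ | h
      · rw [hS, Finset.mem_singleton] at hc
        exact absurd (hc ▸ hc') h2
      · exact h
    have h3 := hne x hx v hv hxv
    have h4 : ∀ k, C.S x v ≠ {k} := by
      intro k hk
      have := hsing v hv u hu x hx huv hxv i k hS hk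
      rw [hk, this] at h2
      simp at h2
    have hj1 : j ∉ C.S v x := C.tri_notMem (C.tri_rot hj)
    have hj2 : j ∉ C.S x v := C.tri_notMem' (C.tri_rot hj)
    have hd : ∀ c, c ∈ C.S v x → c ∉ C.S x v := fun c => C.disj
    -- The colour `i` in `s`, two colours in `t` and `j` outside both already fill the four colours.
    have hfin : ∀ s t : Finset (Fin 4), ∀ i j : Fin 4, i ∈ s → t.Nonempty → (∀ k, t ≠ {k}) →
        j ∉ s → j ∉ t → (∀ c, c ∈ s → c ∉ t) → s = {i} ∧ ∀ c, c ∉ s → c ∉ t → c = j := by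
      intro s t i j a1 a2 a3 a4 a5 a6
      have b1 : 2 ≤ t.card := by
        have := a2.card_pos
        by_contra hlt
        obtain ⟨k, hk⟩ := Finset.card_eq_one.1 (show t.card = 1 by omega)
        exact a3 k hk
      have b2 : Disjoint s t := Finset.disjoint_left.2 a6
      have b3 : j ∉ s ∪ t := by simp [a4, a5]
      have b4 := Finset.card_union_of_disjoint b2
      have b5 := Finset.card_le_univ (insert j (s ∪ t))
      rw [Finset.card_insert_of_notMem b3, b4, Fintype.card_fin] at b5
      have b6 : 1 ≤ s.card := Finset.card_pos.2 ⟨i, a1⟩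
      constructor
      · obtain ⟨k, hk⟩ := Finset.card_eq_one.1 (show s.card = 1 by omega)
        rw [hk] at a1 ⊢
        rw [Finset.mem_singleton.1 a1]
      · intro c c1 c2
        have e : insert j (s ∪ t) = Finset.univ := by
          rw [← Finset.card_eq_iff_eq_univ, Finset.card_insert_of_notMem b3, b4, Fintype.card_fin]
          omega
        have : c ∈ insert j (s ∪ t) := e ▸ Finset.mem_univ c
        simpa [c1, c2] using this
    obtain ⟨e1, e2⟩ := hfin _ _ i j h1 h3 h4 hj1 hj2 hd
    exact ⟨e1, hux, j, hj, fun j' w h => e2 j' (C.tri_notMem h) (C.tri_notMem' h)⟩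
  obtain ⟨x, hx, y, hy, hxv, hyv, hxy, hyx, hno⟩ := bad v hv u hu (Ne.symm hvu) huv
  obtain ⟨hvx, hux, j, hj, hj'⟩ := key v hv u hu (Ne.symm hvu) huv x hx y hy hxv hyv hxy hyx hno
  -- `x` carries the singleton `{i}` from both `v` and `y`. Since `x` fails too, `key` gives
  -- triangles on `vx` and on `yx` with the same third vertex and colour, so `y = v`.
  obtain ⟨x', hx', y', hy', h1, h2, h3, h4, h5⟩ := bad x hx v hv (Ne.symm hxv) hvx
  obtain ⟨-, hvx', j₁, hj₁, -⟩ := key x hx v hv (Ne.symm hxv) hvx x' hx' y' hy' h1 h2 h3 h4 h5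
  obtain rfl := hj' _ _ hj₁
  have hxu : x' = u := C.tri_unique hj₁ (C.tri_rot hj)
  subst hxu
  obtain ⟨-, -, j₂, hj₂, huniq⟩ := key x hx y hy (Ne.symm hxy) hyx x' hx' y' hy' h1 h2 h3 h4 h5
  obtain rfl := huniq _ _ (C.tri_rot hj₁)
  exact hyv (C.tri_unique (C.tri_rot hj₂) (C.tri_rot hj₁))

/-! ### Vertices with two common star colours at `v` -/

/-- In the colours 2 and 3 the class of `av` is a star at `v`, in `p` a star at `a`; only `q` is
left for triangles. -/
theorem tri_of_singleton_zero_one {p q : Fin 4} (hpq : p = 0 ∧ q = 1 ∨ p = 1 ∧ q = 0)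
    {v a w : V} (hav : a ≠ v) (h2 : 2 ∈ C.S a v) (h3 : 3 ∈ C.S a v) (hp : C.S v a = {p})
    (hwv : w ≠ v) (hwa : w ≠ a) (hpw : p ∉ C.S w a) : C.tri q v a w := by
  rcases C.cover hav.symm hwa hwv.symm with ⟨c, hc, hc'⟩ | ⟨c, hc⟩
  · rw [hp, Finset.mem_singleton] at hc
    exact absurd (hc ▸ hc') hpw
  · have e1 : c ∉ C.S v a := C.tri_notMem hc
    have e2 : c ∉ C.S a v := C.tri_notMem' hc
    have e : c = q := by
      have n1 : c ≠ p := by rintro rfl; simp [hp] at e1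
      have n2 : c ≠ 2 := by rintro rfl; exact e2 h2
      have n3 : c ≠ 3 := by rintro rfl; exact e2 h3
      omega
    exact e ▸ hc

theorem tri_of_two_singletons {p q : Fin 4} (hpq : p = 0 ∧ q = 1 ∨ p = 1 ∧ q = 0)
    {v a b : V} (hav : a ≠ v) (h2 : 2 ∈ C.S a v) (h3 : 3 ∈ C.S a v) (hp : C.S v a = {p})
    (hbv : b ≠ v) (h2' : 2 ∈ C.S b v) (h3' : 3 ∈ C.S b v) (hp' : C.S v b = {p}) (hab : a ≠ b) :
    C.tri q v a b := by
  by_cases h : p ∈ C.S b a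
  · exact C.tri_swap_right
      (C.tri_of_singleton_zero_one hpq hbv h2' h3' hp' hav hab (C.disj h))
  · exact C.tri_of_singleton_zero_one hpq hav h2 h3 hp hbv hab.symm h

theorem mem_of_singleton {p q : Fin 4} (hpq : p = 0 ∧ q = 1 ∨ p = 1 ∧ q = 0)
    {v a w : V} (hav : a ≠ v) (h2 : 2 ∈ C.S a v) (h3 : 3 ∈ C.S a v) (hp : C.S v a = {p})
    (hwv : w ≠ v) (hq : q ∈ C.S v w) (hwa : w ≠ a) : p ∈ C.S w a := by
  by_contra h
  exact C.tri_notMem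
    (C.tri_swap_right (C.tri_of_singleton_zero_one hpq hav h2 h3 hp hwv hwa h)) hq

/-- All four colours of `vw` are star colours, so no triangle contains this edge. -/
theorem zero_or_one_mem {v w x : V} (hwv : w ≠ v) (h2 : 2 ∈ C.S w v) (h3 : 3 ∈ C.S w v)
    (h01 : C.S v w = {0, 1}) (hxv : x ≠ v) (hxw : x ≠ w) : 0 ∈ C.S x w ∨ 1 ∈ C.S x w := by
  rcases C.cover hwv.symm hxw hxv.symm with ⟨c, hc, hc'⟩ | ⟨c, hc⟩
  · simp only [h01, Finset.mem_insert, Finset.mem_singleton] at hc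
    rcases hc with rfl | rfl
    · exact Or.inl hc'
    · exact Or.inr hc'
  · have e1 : c ∉ C.S v w := C.tri_notMem hc
    have e2 : c ∉ C.S w v := C.tri_notMem' hc
    simp only [h01, Finset.mem_insert, Finset.mem_singleton, not_or] at e1
    have n2 : c ≠ 2 := by rintro rfl; exact e2 h2
    have n3 : c ≠ 3 := by rintro rfl; exact e2 h3
    omega

/-- If all `S x y` contain `0` or `1` then only two bits of the type matter. -/
theorem exists_two_bit_type_map (U : Finset V) (v : V) (hv : v ∉ U)
    (h01 : ∀ x ∈ U, ∀ y ∈ U, x ≠ y → 0 ∈ C.S x y ∨ 1 ∈ C.S x y)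
    (r₀ r₁ : V) (hr₀ : r₀ ∉ U) (hr₁ : r₁ ∉ U)
    (htri₀ : ∀ x ∈ U, ∀ y ∈ U, x ≠ y → C.S y x = {0} → ∃ c, C.tri c r₀ y x)
    (htri₁ : ∀ x ∈ U, ∀ y ∈ U, x ≠ y → C.S y x = {1} → ∃ c, C.tri c r₁ y x)
    (hr : ∀ x ∈ U, ∀ y ∈ U, x ≠ y → C.S y x = {0} → C.S x y = {1} → r₀ ≠ r₁) :
    ∃ τ : V → Bool × Bool, Set.InjOn τ U ∧ ∀ x ∈ U, ∀ y ∈ U, x ≠ y →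
      ((τ x).1 ≠ (τ y).1 ∧ C.S x y ⊆ side 1 (τ y).1) ∨
      ((τ x).2 ≠ (τ y).2 ∧ C.S x y ⊆ side 2 (τ y).2) := by
  have hsing : ∀ x ∈ U, ∀ y ∈ U, x ≠ y → ∀ i, C.S y x = {i} → i = 0 ∨ i = 1 := by
    intro x hx y hy hxy i hi
    have := h01 y hy x hx hxy.symm
    rw [hi, Finset.mem_singleton, Finset.mem_singleton] at this
    exact this.imp Eq.symm Eq.symm
  -- Only `{0}` and `{1}` occur as singletons; the last two entries are fillers outside `U`.
  obtain ⟨τ, hτ⟩ := C.exists_type_map U ![r₀, r₁, v, v]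
    (by intro i; fin_cases i <;> simp [hr₀, hr₁, hv])
    (by
      intro x hx y hy hxy
      rcases h01 x hx y hy hxy with h | h
      exacts [⟨_, h⟩, ⟨_, h⟩])
    (by
      intro x hx y hy hxy i hi
      rcases hsing x hx y hy hxy i hi with rfl | rfl
      · exact htri₀ x hx y hy hxy hi
      · exact htri₁ x hx y hy hxy hi)
    (by
      intro x hx y hy hxy i k hi hk
      have hik : i ≠ k := by
        rintro rfl
        exact C.disj (c := i) (u := y) (v := x) (by simp [hi]) (by simp [hk])
      rcases hsing x hx y hy hxy i hi with rfl | rfl <;>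
        rcases hsing y hy x hx hxy.symm k hk with rfl | rfl
      · exact absurd rfl hik
      · exact hr x hx y hy hxy hi hk
      · exact (hr y hy x hx hxy.symm hk hi).symm
      · exact absurd rfl hik)
  have hmain : ∀ x ∈ U, ∀ y ∈ U, x ≠ y →
      (τ x 1 ≠ τ y 1 ∧ C.S x y ⊆ side 1 (τ y 1)) ∨
      (τ x 2 ≠ τ y 2 ∧ C.S x y ⊆ side 2 (τ y 2)) := by
    intro x hx y hy hxy
    obtain ⟨j, hj, hs, hs'⟩ := hτ x hx y hy hxy
    -- No `S z w` fits into the half `{2, 3}`, so splitting 0 cannot be the one that separates `x`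
    -- and `y`.
    have hzero : ∀ z w : V, (0 ∈ C.S z w ∨ 1 ∈ C.S z w) → ¬ C.S z w ⊆ side 0 false := by
      intro z w h hsub
      rcases h with h | h
      · exact absurd (hsub h) (by decide)
      · exact absurd (hsub h) (by decide)
    have n1 := hzero x y (h01 x hx y hy hxy)
    have n2 := hzero y x (h01 y hy x hx hxy.symm)
    fin_cases j
    · simp only [Fin.zero_eta] at hj hs hs'
      cases h : τ y 0
      · exact absurd (h ▸ hs) n1
      · cases h' : τ x 0
        · exact absurd (h' ▸ hs') n2
        · exact absurd (h'.trans h.symm) hj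
    · exact Or.inl ⟨hj, hs⟩
    · exact Or.inr ⟨hj, hs⟩
  refine ⟨fun x => (τ x 1, τ x 2), ?_, hmain⟩
  intro x hx y hy hxy
  by_contra hne
  simp only [Prod.mk.injEq] at hxy
  rcases hmain x hx y hy hne with h | h
  · exact h.1 hxy.1
  · exact h.1 hxy.2

theorem card_le_four_of_injOn {U : Finset V} {τ : V → Bool × Bool} (h : Set.InjOn τ U) :
    U.card ≤ 4 :=
  Finset.card_le_card_of_injOn τ (t := Finset.univ) (fun _ _ => Finset.mem_univ _) h

/-- Both singletons `{0}` and `{1}` at one vertex leave room for few vertices. -/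
theorem card_le_five_of_two_singletons (U : Finset V)
    (h01 : ∀ x ∈ U, ∀ y ∈ U, x ≠ y → 0 ∈ C.S x y ∨ 1 ∈ C.S x y)
    {w x y : V} (hw : w ∈ U) (hx : x ∈ U) (hy : y ∈ U) (hxw : x ≠ w) (hyw : y ≠ w)
    (hx0 : C.S x w = {0}) (hy1 : C.S y w = {1}) : U.card ≤ 5 := by
  classical
  have hxy : x ≠ y := by
    rintro rfl
    rw [hx0] at hy1
    exact absurd hy1 (by decide)
  have hcol : ∀ {p q : Fin 4}, (p = 0 ∧ q = 1 ∨ p = 1 ∧ q = 0) → ∀ {a : V}, a ∈ U → a ≠ w →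
      C.S a w = {p} → ∀ {c z}, C.tri c a w z → c = 2 ∨ c = 3 := by
    intro p q hpq a ha haw hS c z hc
    have e1 : c ∉ C.S a w := C.tri_notMem hc
    have e2 : c ∉ C.S w a := C.tri_notMem' hc
    have e3 : q ∈ C.S w a := by
      have hp : p ∉ C.S w a := C.disj (by simp [hS])
      rcases hpq with ⟨rfl, rfl⟩ | ⟨rfl, rfl⟩
      · exact (h01 w hw a ha haw.symm).resolve_left hp
      · exact (h01 w hw a ha haw.symm).resolve_right hp
    rw [hS, Finset.mem_singleton] at e1
    have e4 : c ≠ q := by rintro rfl; exact e2 e3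
    omega
  obtain ⟨c₀, hc₀⟩ : ∃ c, C.tri c x w y := by
    rcases C.cover hxw hyw hxy with ⟨c, hc, hc'⟩ | h
    · rw [hx0, Finset.mem_singleton] at hc
      rw [hy1, hc] at hc'
      exact absurd hc' (by decide)
    · exact h
  have hc₀' : C.tri c₀ y w x := C.tri_swap (C.tri_rot hc₀)
  -- Only the colours 2 and 3 are free for triangles on `aw`, and `c₀` is taken by the triangle with
  -- `b`.
  have hfew : ∀ {p q : Fin 4}, (p = 0 ∧ q = 1 ∨ p = 1 ∧ q = 0) → ∀ {a b : V}, a ∈ U → a ≠ w →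
      C.S a w = {p} → C.tri c₀ a w b →
      (U.filter fun z => z ≠ w ∧ z ≠ a ∧ z ≠ b ∧ p ∉ C.S z w).card ≤ 1 := by
    intro p q hpq a b ha haw hS hab
    have h23 := hcol hpq ha haw hS hab
    have h1 : (({2, 3} : Finset (Fin 4)).erase c₀).card = 1 := by
      rcases h23 with h | h <;> rw [h] <;> decide
    rw [← h1]
    refine C.card_le_of_tri (u := a) (v := w) _ _ ?_
    intro z hz
    obtain ⟨hzU, hzw, hza, hzb, hpz⟩ := Finset.mem_filter.1 hz
    rcases C.cover haw hzw hza.symm with ⟨c, hc, hc'⟩ | ⟨c, hc⟩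
    · rw [hS, Finset.mem_singleton] at hc
      exact absurd (hc ▸ hc') hpz
    · refine ⟨c, Finset.mem_erase.2 ⟨?_, ?_⟩, hc⟩
      · exact fun e => hzb (C.tri_unique (e ▸ hc) hab)
      · simpa using hcol hpq ha haw hS hc
  have f0 := hfew (p := 0) (q := 1) (Or.inl ⟨rfl, rfl⟩) hx hxw hx0 hc₀
  have f1 := hfew (p := 1) (q := 0) (Or.inr ⟨rfl, rfl⟩) hy hyw hy1 hc₀'
  have hsub : U ⊆ {w, x, y} ∪ ((U.filter fun z => z ≠ w ∧ z ≠ x ∧ z ≠ y ∧ 0 ∉ C.S z w) ∪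
      (U.filter fun z => z ≠ w ∧ z ≠ y ∧ z ≠ x ∧ 1 ∉ C.S z w)) := by
    intro z hz
    simp only [Finset.mem_union, Finset.mem_insert, Finset.mem_singleton, Finset.mem_filter]
    by_cases e1 : z = w
    · exact Or.inl (Or.inl e1)
    by_cases e2 : z = x
    · exact Or.inl (Or.inr (Or.inl e2))
    by_cases e3 : z = y
    · exact Or.inl (Or.inr (Or.inr e3))
    right
    by_cases e4 : 0 ∈ C.S z w
    · right
      refine ⟨hz, e1, e3, e2, fun e5 => ?_⟩
      rcases h01 w hw z hz (Ne.symm e1) with h | h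
      · exact C.disj h e4
      · exact C.disj h e5
    · exact Or.inl ⟨hz, e1, e2, e3, e4⟩
  have g1 := Finset.card_le_card hsub
  have g2 := Finset.card_union_le ({w, x, y} : Finset V)
    ((U.filter fun z => z ≠ w ∧ z ≠ x ∧ z ≠ y ∧ 0 ∉ C.S z w) ∪
      (U.filter fun z => z ≠ w ∧ z ≠ y ∧ z ≠ x ∧ 1 ∉ C.S z w))
  have g3 := Finset.card_union_le (U.filter fun z => z ≠ w ∧ z ≠ x ∧ z ≠ y ∧ 0 ∉ C.S z w)
      (U.filter fun z => z ≠ w ∧ z ≠ y ∧ z ≠ x ∧ 1 ∉ C.S z w)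
  have g4 : ({w, x, y} : Finset V).card ≤ 3 := Finset.card_le_three
  omega

/-- Two vertices with `S v a = S v a' = {0}` cannot occur together with a vertex `t` that has the
full type `{0, 2}`, `{0, 3}`. -/
theorem false_of_two_singletons_of_type {v a a' t x y : V}
    (hav : a ≠ v) (ha2 : 2 ∈ C.S a v) (ha3 : 3 ∈ C.S a v) (ha : C.S v a = {0})
    (ha'v : a' ≠ v) (ha'2 : 2 ∈ C.S a' v) (ha'3 : 3 ∈ C.S a' v) (ha' : C.S v a' = {0})
    (haa' : a ≠ a')
    (htv : t ≠ v) (ht2 : 2 ∈ C.S t v) (ht3 : 3 ∈ C.S t v) (ht : C.S v t = {0, 1})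
    (hx : C.S v x = {0, 1}) (hy : C.S v y = {0, 1}) (hxt : x ≠ t) (hyt : y ≠ t) (hxy : x ≠ y)
    (hSx : C.S x t ⊆ {0, 3}) (hSy : C.S y t ⊆ {0, 2}) : False := by
  wlog h0 : 0 ∉ C.S a' a generalizing a a'
  · exact this ha'v ha'2 ha'3 ha' hav ha2 ha3 ha haa'.symm (C.disj (not_not.1 h0))
  have hne : ∀ {b z : V}, C.S v b = {0} → C.S v z = {0, 1} → b ≠ z := by
    rintro b z hb hz rfl
    rw [hb] at hz
    exact absurd hz (by decide)
  have h1 : C.tri 1 v a a' :=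
    C.tri_of_two_singletons (p := 0) (Or.inl ⟨rfl, rfl⟩) hav ha2 ha3 ha ha'v ha'2 ha'3 ha' haa'
  have hta : 0 ∈ C.S t a := C.mem_of_singleton (p := 0) (q := 1) (Or.inl ⟨rfl, rfl⟩) hav ha2 ha3 ha
    htv (by simp [ht]) (hne ha ht).symm
  have hat0 : 0 ∉ C.S a t := C.disj hta
  have hat1 : 1 ∈ C.S a t :=
    (C.zero_or_one_mem htv ht2 ht3 ht hav (hne ha ht)).resolve_left hat0
  have hta1 : 1 ∉ C.S t a := C.disj hat1
  have hcol : ∀ {c z}, C.tri c a t z → c = 2 ∨ c = 3 := by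
    intro c z hc
    have e1 : c ≠ 0 := by rintro rfl; exact C.tri_notMem' hc hta
    have e2 : c ≠ 1 := by rintro rfl; exact C.tri_notMem hc hat1
    omega
  have k1 : ∃ c, (c = 2 ∨ c = 3) ∧ (c ∈ C.S t a ∨ C.tri c a t a') := by
    rcases C.cover (hne ha ht).symm haa'.symm (hne ha' ht).symm with ⟨c, hc, hc'⟩ | ⟨c, hc⟩
    · have e1 : c ≠ 0 := by rintro rfl; exact h0 hc'
      have e2 : c ≠ 1 := by rintro rfl; exact hta1 hc
      exact ⟨c, by omega, Or.inl hc⟩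
    · exact ⟨c, hcol (C.tri_swap hc), Or.inr (C.tri_swap hc)⟩
  have k2 : ∀ {z : V} {d : Fin 4}, C.S z t ⊆ {0, d} → C.S v z = {0, 1} → z ≠ t →
      d ∈ C.S a t ∨ ∃ c, (c = 2 ∨ c = 3) ∧ C.tri c a t z := by
    intro z d hSz hz hzt
    rcases C.cover hzt (hne ha ht) (hne ha hz).symm with ⟨c, hc, hc'⟩ | ⟨c, hc⟩
    · have := hSz hc
      rw [Finset.mem_insert, Finset.mem_singleton] at this
      rcases this with rfl | rfl
      · exact absurd hc' hat0
      · exact Or.inl hc'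
    · have hc := C.tri_swap (C.tri_rot hc)
      exact Or.inr ⟨c, hcol hc, hc⟩
  have kx := k2 hSx hx hxt
  have ky := k2 hSy hy hyt
  have hd : ∀ {c}, c ∈ C.S t a → c ∉ C.S a t := fun h => C.disj h
  have hn : ∀ {c z}, C.tri c a t z → c ∉ C.S a t := fun h => C.tri_notMem h
  have hn' : ∀ {c z}, C.tri c a t z → c ∉ C.S t a := fun h => C.tri_notMem' h
  have hu : ∀ {c z z'}, C.tri c a t z → C.tri c a t z' → z = z' := fun h h' => C.tri_unique h h'
  have ex := hne ha' hx
  have ey := hne ha' hy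
  clear k2 hcol hta hta1 hat0 hat1 h1 hne hSx hSy
  -- Pigeonhole on the edge `at`: `k`, `kx` and `ky` each claim one of the colours 2 and 3, and no
  -- colour can satisfy two of these claims.
  obtain ⟨c, hc, k⟩ := k1
  rcases kx with kx | ⟨d, hd', kx⟩ <;> rcases ky with ky | ⟨e, he, ky⟩
  · rcases k with k | k <;> rcases hc with rfl | rfl
    · exact hd k ky
    · exact hd k kx
    · exact hn k ky
    · exact hn k kx
  · have : e = 2 := he.resolve_right (by rintro rfl; exact hn ky kx)
    subst this
    rcases k with k | k <;> rcases hc with rfl | rfl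
    · exact hn' ky k
    · exact hd k kx
    · exact ey (hu k ky)
    · exact hn k kx
  · have : d = 3 := hd'.resolve_left (by rintro rfl; exact hn kx ky)
    subst this
    rcases k with k | k <;> rcases hc with rfl | rfl
    · exact hd k ky
    · exact hn' kx k
    · exact hn k ky
    · exact ex (hu k kx)
  · have hde : d ≠ e := by rintro rfl; exact hxy (hu kx ky)
    have : c = d ∨ c = e := by omega
    rcases k with k | k <;> rcases this with rfl | rfl
    · exact hn' kx k
    · exact hn' ky k
    · exact ex (hu k kx)
    · exact ey (hu k ky)

/-- Let `A p` and `D` collect the `w` with `S v w` equal to `{p}` and `{0, 1}`. Each `A p` has at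
most two vertices, and `D` has at most four besides the repairing vertices it contains. A nonempty
`A p` supplies a repairing vertex outside `D`, so only the sizes 2, 2, 4 can reach eight;
`false_of_two_singletons_of_type` excludes them. -/
theorem false_of_card_eight [DecidableEq V] (hne : ∀ {x y : V}, x ≠ y → (C.S x y).Nonempty)
    (v : V) (W : Finset V) (hW : ∀ w ∈ W, w ≠ v ∧ 2 ∈ C.S w v ∧ 3 ∈ C.S w v)
    (hcard : 8 ≤ W.card) : False := by
  have hsub : ∀ w ∈ W, C.S v w = {0} ∨ C.S v w = {1} ∨ C.S v w = {0, 1} := by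
    intro w hw
    obtain ⟨h1, h2, h3⟩ := hW w hw
    have h := hne h1.symm
    have e2 : 2 ∉ C.S v w := fun h => C.disj h h2
    have e3 : 3 ∉ C.S v w := fun h => C.disj h h3
    revert h e2 e3
    generalize C.S v w = s
    revert s
    decide
  set A : Fin 4 → Finset V := fun p => W.filter fun w => C.S v w = {p} with hA
  set D : Finset V := W.filter fun w => C.S v w = {0, 1} with hD
  have memA : ∀ {p a}, a ∈ A p ↔ a ∈ W ∧ C.S v a = {p} := by intro p a; simp [hA]
  have memD : ∀ {a}, a ∈ D ↔ a ∈ W ∧ C.S v a = {0, 1} := by intro a; simp [hD]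
  have hAD : ∀ {p a}, a ∈ A p → a ∉ D := by
    intro p a h h'
    have := (memA.1 h).2
    rw [(memD.1 h').2] at this
    exact (by decide : ∀ p : Fin 4, ({0, 1} : Finset (Fin 4)) ≠ {p}) p this
  have hsum : 8 ≤ (A 0).card + (A 1).card + D.card := by
    have h1 : W ⊆ A 0 ∪ A 1 ∪ D := by
      intro w hw
      rw [Finset.mem_union, Finset.mem_union, memA, memA, memD]
      rcases hsub w hw with h | h | h
      · exact Or.inl (Or.inl ⟨hw, h⟩)
      · exact Or.inl (Or.inr ⟨hw, h⟩)
      · exact Or.inr ⟨hw, h⟩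
    have h2 := Finset.card_le_card h1
    have h3 := Finset.card_union_le (A 0 ∪ A 1) D
    have h4 := Finset.card_union_le (A 0) (A 1)
    omega
  have hA2 : ∀ p q : Fin 4, (p = 0 ∧ q = 1 ∨ p = 1 ∧ q = 0) → (A p).card ≤ 2 := by
    intro p q hpq
    by_contra h
    obtain ⟨a, b, c, ha, hb, hc, hab, hac, hbc⟩ := Finset.two_lt_card_iff.1 (not_le.1 h)
    obtain ⟨ha, ha'⟩ := memA.1 ha
    obtain ⟨hb, hb'⟩ := memA.1 hb
    obtain ⟨hc, hc'⟩ := memA.1 hc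
    obtain ⟨a1, a2, a3⟩ := hW a ha
    obtain ⟨b1, b2, b3⟩ := hW b hb
    obtain ⟨c1, c2, c3⟩ := hW c hc
    exact hbc (C.tri_unique (C.tri_of_two_singletons hpq a1 a2 a3 ha' b1 b2 b3 hb' hab)
      (C.tri_of_two_singletons hpq a1 a2 a3 ha' c1 c2 c3 hc' hac))
  have hA0 := hA2 0 1 (Or.inl ⟨rfl, rfl⟩)
  have hA1 := hA2 1 0 (Or.inr ⟨rfl, rfl⟩)
  have h01 : ∀ x ∈ D, ∀ y ∈ D, x ≠ y → 0 ∈ C.S x y ∨ 1 ∈ C.S x y := by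
    intro x hx y hy hxy
    obtain ⟨hy, hy'⟩ := memD.1 hy
    obtain ⟨y1, y2, y3⟩ := hW y hy
    exact C.zero_or_one_mem y1 y2 y3 hy' (hW x (memD.1 hx).1).1 hxy
  -- the repairing vertices of the colours `0` and `1`
  have hR : ∀ p q : Fin 4, (p = 0 ∧ q = 1 ∨ p = 1 ∧ q = 0) → ∃ r,
      (r ∈ A p ∨ A p = ∅ ∧ r ∈ D ∧ ((∃ x ∈ D, x ≠ r ∧ C.S x r = {p}) ∨
        ∀ x ∈ D, ∀ y ∈ D, x ≠ y → C.S y x ≠ {p})) ∧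
      ∀ x ∈ D, ∀ y ∈ D, x ≠ r → y ≠ r → x ≠ y → C.S y x = {p} → ∃ c, C.tri c r y x := by
    intro p q hpq
    rcases (A p).eq_empty_or_nonempty with he | ⟨a, ha⟩
    · have hD6 : 6 ≤ D.card := by
        have : (A p).card = 0 := by simp [he]
        rcases hpq with ⟨rfl, rfl⟩ | ⟨rfl, rfl⟩ <;> omega
      have hDne : D.Nonempty := Finset.card_pos.1 (by omega)
      obtain ⟨r, hr, h1, h2⟩ := C.exists_repairing_vertex D hDne (fun x _ y _ h => hne h) (by
        intro w hw x hx y hy hxw hyw i k hi hk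
        have hi' := h01 x hx w hw hxw
        have hk' := h01 y hy w hw hyw
        rw [hi, Finset.mem_singleton, Finset.mem_singleton] at hi'
        rw [hk, Finset.mem_singleton, Finset.mem_singleton] at hk'
        by_contra hik
        rcases hi' with rfl | rfl <;> rcases hk' with rfl | rfl
        · exact hik rfl
        · have := C.card_le_five_of_two_singletons D h01 hw hx hy hxw hyw hi hk
          omega
        · have := C.card_le_five_of_two_singletons D h01 hw hy hx hyw hxw hk hi
          omega
        · exact hik rfl) p
      exact ⟨r, Or.inr ⟨he, hr, h1⟩, h2⟩
    · refine ⟨a, Or.inl ha, ?_⟩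
      intro x hx y hy hxa hya hxy hS
      obtain ⟨ha, ha'⟩ := memA.1 ha
      obtain ⟨a1, a2, a3⟩ := hW a ha
      obtain ⟨hx, hx'⟩ := memD.1 hx
      have hq : q ∈ C.S v x := by
        rw [hx']
        rcases hpq with ⟨rfl, rfl⟩ | ⟨rfl, rfl⟩ <;> decide
      have h1 : p ∈ C.S x a := C.mem_of_singleton hpq a1 a2 a3 ha' (hW x hx).1 hq hxa
      rcases C.cover hxy.symm hxa.symm hya with ⟨c, hc, hc'⟩ | ⟨c, hc⟩
      · rw [hS, Finset.mem_singleton] at hc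
        exact absurd (hc ▸ hc') (C.disj h1)
      · exact ⟨c, C.tri_rot (C.tri_rot hc)⟩
  obtain ⟨r₀, hr₀, hrep₀⟩ := hR 0 1 (Or.inl ⟨rfl, rfl⟩)
  obtain ⟨r₁, hr₁, hrep₁⟩ := hR 1 0 (Or.inr ⟨rfl, rfl⟩)
  set U := (D.erase r₀).erase r₁ with hU
  have memU : ∀ {x}, x ∈ U ↔ x ≠ r₁ ∧ x ≠ r₀ ∧ x ∈ D := by intro x; simp [hU]
  obtain ⟨τ, hinj, hτ⟩ := C.exists_two_bit_type_map U v
    (fun h => (hW v (memD.1 (memU.1 h).2.2).1).1 rfl)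
    (fun x hx y hy => h01 x (memU.1 hx).2.2 y (memU.1 hy).2.2) r₀ r₁
    (fun h => (memU.1 h).2.1 rfl) (fun h => (memU.1 h).1 rfl)
    (fun x hx y hy hxy h => hrep₀ x (memU.1 hx).2.2 y (memU.1 hy).2.2 (memU.1 hx).2.1
      (memU.1 hy).2.1 hxy h)
    (fun x hx y hy hxy h => hrep₁ x (memU.1 hx).2.2 y (memU.1 hy).2.2 (memU.1 hx).1
      (memU.1 hy).1 hxy h)
    (by
      intro x hx y hy hxy hyx hxy' hrr
      have hx := (memU.1 hx).2.2
      have hy := (memU.1 hy).2.2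
      -- A common repairing vertex must lie in `D` and would carry both `{0}` and `{1}`. Then `D`
      -- has at most five vertices, but it has eight as `A 0` and `A 1` are empty.
      rcases hr₀ with h | ⟨he, hd, hz⟩ <;> rcases hr₁ with h' | ⟨he', hd', hz'⟩
      · have h1 := (memA.1 h).2
        rw [hrr, (memA.1 h').2] at h1
        exact absurd h1 (by decide)
      · exact hAD h (hrr ▸ hd')
      · exact hAD h' (hrr ▸ hd)
      · rcases hz with ⟨z, hz, hzr, hzS⟩ | hz
        · rcases hz' with ⟨z', hz', hzr', hzS'⟩ | hz'
          · have := C.card_le_five_of_two_singletons D h01 hd hz hz' hzr (hrr ▸ hzr') hzS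
              (hrr ▸ hzS')
            have e0 : (A 0).card = 0 := by simp [he]
            have e1 : (A 1).card = 0 := by simp [he']
            omega
          · exact hz' y hy x hx hxy.symm hxy'
        · exact hz x hx y hy hxy hyx)
  have hU4 := card_le_four_of_injOn hinj
  have c1 := Finset.pred_card_le_card_erase (s := D) (a := r₀)
  have c2 := Finset.pred_card_le_card_erase (s := D.erase r₀) (a := r₁)
  rw [← hU] at c2
  -- both colours have a vertex outside `D`
  have g₀ : r₀ ∈ A 0 := by
    refine hr₀.resolve_right ?_
    rintro ⟨he, -⟩
    have e0 : (A 0).card = 0 := by simp [he]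
    rcases hr₁ with h | ⟨he', -⟩
    · rw [Finset.erase_eq_of_notMem (a := r₁) (fun h' => hAD h (Finset.mem_of_mem_erase h'))] at hU
      rw [← hU] at c1
      omega
    · have e1 : (A 1).card = 0 := by simp [he']
      omega
  have hUD₀ : D.erase r₀ = D := Finset.erase_eq_of_notMem (hAD g₀)
  rw [hUD₀] at c2 hU
  have g₁ : r₁ ∈ A 1 := by
    refine hr₁.resolve_right ?_
    rintro ⟨he, -⟩
    have e0 : (A 1).card = 0 := by simp [he]
    omega
  rw [Finset.erase_eq_of_notMem (hAD g₁)] at hU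
  -- All bounds are now equalities, so all four types occur in `U = D`.
  have hA0' : 1 < (A 0).card := by rw [hU] at hU4; omega
  have hD4 : U.card = 4 := by rw [hU] at hU4 ⊢; omega
  have himg : U.image τ = Finset.univ := by
    rw [← Finset.card_eq_iff_eq_univ, Finset.card_image_of_injOn hinj, hD4]
    rfl
  have hsurj : ∀ b, ∃ x ∈ U, τ x = b := fun b =>
    Finset.mem_image.1 (himg ▸ Finset.mem_univ b)
  obtain ⟨t, ht, htτ⟩ := hsurj (true, true)
  obtain ⟨x, hx, hxτ⟩ := hsurj (true, false)
  obtain ⟨y, hy, hyτ⟩ := hsurj (false, true)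
  have hxt : x ≠ t := by rintro rfl; simp [htτ] at hxτ
  have hyt : y ≠ t := by rintro rfl; simp [htτ] at hyτ
  have hxy : x ≠ y := by rintro rfl; simp [hxτ] at hyτ
  have hSx : C.S x t ⊆ {0, 3} := by
    rcases hτ x hx t ht hxt with h | h
    · simp [hxτ, htτ] at h
    · rw [htτ] at h
      exact h.2
  have hSy : C.S y t ⊆ {0, 2} := by
    rcases hτ y hy t ht hyt with h | h
    · rw [htτ] at h
      exact h.2
    · simp [hyτ, htτ] at h
  obtain ⟨a, ha, a', ha', haa'⟩ := Finset.one_lt_card.1 hA0'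
  obtain ⟨ha, ha0⟩ := memA.1 ha
  obtain ⟨ha', ha'0⟩ := memA.1 ha'
  rw [hU] at ht hx hy
  obtain ⟨ht, ht0⟩ := memD.1 ht
  obtain ⟨a1, a2, a3⟩ := hW a ha
  obtain ⟨b1, b2, b3⟩ := hW a' ha'
  obtain ⟨t1, t2, t3⟩ := hW t ht
  exact C.false_of_two_singletons_of_type a1 a2 a3 ha0 b1 b2 b3 ha'0 haa' t1 t2 t3 ht0
    (memD.1 hx).2 (memD.1 hy).2 hxt hyt hxy hSx hSy

/-! ### Two different singletons at one vertex -/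

/-- Apart from `v`, `u`, `u'`, at most one vertex `z` misses the colour 2 in `S z v` and at most one
misses 3, which leaves 13 - 3 - 2 = 8 vertices for `false_of_card_eight`. -/
theorem false_of_singletons_two_three [Fintype V] [DecidableEq V] (hV : 13 ≤ Fintype.card V)
    {v u u' : V} (huv : u ≠ v) (hu'v : u' ≠ v) (h2 : C.S u v = {2}) (h3 : C.S u' v = {3})
    (h0 : C.tri 0 u v u') : False := by
  have hne : ∀ {x y : V}, x ≠ y → (C.S x y).Nonempty := C.S_nonempty (by omega)
  have hfew : ∀ {p q : Fin 4}, (p = 2 ∧ q = 3 ∨ p = 3 ∧ q = 2) → ∀ {a b : V}, a ≠ v →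
      C.S a v = {p} → C.tri 0 a v b →
      (Finset.univ.filter fun z => z ≠ v ∧ z ≠ a ∧ z ≠ b ∧ p ∉ C.S z v).card ≤ 1 := by
    intro p q hpq a b hav hS hab
    -- Triangles on `av` with a third vertex other than `b` have colour 1 or `q`, and the nonempty
    -- set `S v a`, which avoids 0 and `p`, uses up one of these.
    have h1 : (({1, q} : Finset (Fin 4)) \ C.S v a).card ≤ 1 := by
      have e1 := hne hav.symm
      have e2 : p ∉ C.S v a := C.disj (by simp [hS])
      have e3 : 0 ∉ C.S v a := C.tri_notMem' hab
      revert e1 e2 e3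
      generalize C.S v a = s
      revert s
      rcases hpq with ⟨rfl, rfl⟩ | ⟨rfl, rfl⟩ <;> decide
    refine le_trans (C.card_le_of_tri (u := a) (v := v) _ _ ?_) h1
    intro z hz
    obtain ⟨-, hzv, hza, hzb, hpz⟩ := Finset.mem_filter.1 hz
    rcases C.cover hav hzv hza.symm with ⟨c, hc, hc'⟩ | ⟨c, hc⟩
    · rw [hS, Finset.mem_singleton] at hc
      exact absurd (hc ▸ hc') hpz
    · refine ⟨c, Finset.mem_sdiff.2 ⟨?_, C.tri_notMem' hc⟩, hc⟩
      have e1 : c ≠ 0 := fun e => hzb (C.tri_unique (e ▸ hc) hab)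
      have e2 : c ∉ C.S a v := C.tri_notMem hc
      rw [hS, Finset.mem_singleton] at e2
      rw [Finset.mem_insert, Finset.mem_singleton]
      omega
  have f2 := hfew (Or.inl ⟨rfl, rfl⟩) huv h2 h0
  have f3 := hfew (Or.inr ⟨rfl, rfl⟩) hu'v h3 (C.tri_swap (C.tri_rot h0))
  refine C.false_of_card_eight hne v
    (Finset.univ.filter fun w => w ≠ v ∧ 2 ∈ C.S w v ∧ 3 ∈ C.S w v)
    (fun w hw => (Finset.mem_filter.1 hw).2) ?_
  have hsub : (Finset.univ : Finset V) ⊆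
      (Finset.univ.filter fun w => w ≠ v ∧ 2 ∈ C.S w v ∧ 3 ∈ C.S w v) ∪ ({v, u, u'} ∪
      ((Finset.univ.filter fun z => z ≠ v ∧ z ≠ u ∧ z ≠ u' ∧ 2 ∉ C.S z v) ∪
      (Finset.univ.filter fun z => z ≠ v ∧ z ≠ u' ∧ z ≠ u ∧ 3 ∉ C.S z v))) := by
    intro z _
    simp only [Finset.mem_union, Finset.mem_insert, Finset.mem_singleton, Finset.mem_filter,
      Finset.mem_univ, true_and]
    tauto
  have g := Finset.card_le_card hsub
  have g1 := Finset.card_union_le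
    (Finset.univ.filter fun w => w ≠ v ∧ 2 ∈ C.S w v ∧ 3 ∈ C.S w v) ({v, u, u'} ∪
      ((Finset.univ.filter fun z => z ≠ v ∧ z ≠ u ∧ z ≠ u' ∧ 2 ∉ C.S z v) ∪
      (Finset.univ.filter fun z => z ≠ v ∧ z ≠ u' ∧ z ≠ u ∧ 3 ∉ C.S z v)))
  have g2 := Finset.card_union_le ({v, u, u'} : Finset V)
      ((Finset.univ.filter fun z => z ≠ v ∧ z ≠ u ∧ z ≠ u' ∧ 2 ∉ C.S z v) ∪
      (Finset.univ.filter fun z => z ≠ v ∧ z ≠ u' ∧ z ≠ u ∧ 3 ∉ C.S z v))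
  have g3 := Finset.card_union_le
      (Finset.univ.filter fun z => z ≠ v ∧ z ≠ u ∧ z ≠ u' ∧ 2 ∉ C.S z v)
      (Finset.univ.filter fun z => z ≠ v ∧ z ≠ u' ∧ z ≠ u ∧ 3 ∉ C.S z v)
  have g4 : ({v, u, u'} : Finset V).card ≤ 3 := Finset.card_le_three
  rw [Finset.card_univ] at g
  omega

theorem eq_of_singletons [Fintype V] [DecidableEq V] (hV : 13 ≤ Fintype.card V)
    {v u u' : V} (huv : u ≠ v) (hu'v : u' ≠ v) {i k : Fin 4} (hi : C.S u v = {i})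
    (hk : C.S u' v = {k}) : i = k := by
  by_contra hik
  have huu' : u ≠ u' := by
    rintro rfl
    rw [hi] at hk
    exact hik (Finset.singleton_inj.1 hk)
  obtain ⟨c, hc⟩ : ∃ c, C.tri c u v u' := by
    rcases C.cover huv hu'v huu' with ⟨c, hc, hc'⟩ | h
    · rw [hi, Finset.mem_singleton] at hc
      rw [hk, hc, Finset.mem_singleton] at hc'
      exact absurd hc' hik
    · exact h
  have hci : c ≠ i := by
    have := C.tri_notMem hc
    rwa [hi, Finset.mem_singleton] at this
  have hck : c ≠ k := by
    have := C.tri_notMem (C.tri_swap (C.tri_rot hc))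
    rwa [hk, Finset.mem_singleton] at this
  obtain ⟨σ, h0, h2, h3⟩ : ∃ σ : Equiv.Perm (Fin 4), σ c = 0 ∧ σ i = 2 ∧ σ k = 3 := by
    have := (by decide : ∀ c i k : Fin 4, c ≠ i → c ≠ k → i ≠ k →
      ∃ σ : Equiv.Perm (Fin 4), σ c = 0 ∧ σ i = 2 ∧ σ k = 3)
    exact this c i k hci hck hik
  refine (C.relabel σ).false_of_singletons_two_three hV huv hu'v ?_ ?_ ?_
  · change (C.S u v).map σ.toEmbedding = {2}
    rw [hi, Finset.map_singleton]
    simp [h2]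
  · change (C.S u' v).map σ.toEmbedding = {3}
    rw [hk, Finset.map_singleton]
    simp [h3]
  · change C.tri (σ.symm 0) u v u'
    rwa [← h0, Equiv.symm_apply_apply]

/-! ### The bound on the number of vertices -/

/-- Four partitions into stars and triangles do not suffice for 13 vertices. -/
theorem card_lt_thirteen {V : Type*} [Fintype V] (C : StarTriangleCover V) : Fintype.card V < 13 := by
  classical
  by_contra hV
  rw [not_lt] at hV
  have hne : ∀ {x y : V}, x ≠ y → (C.S x y).Nonempty := C.S_nonempty (by omega)
  have hsing : ∀ {v u u' : V}, u ≠ v → u' ≠ v → ∀ {i k}, C.S u v = {i} → C.S u' v = {k} → i = k :=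
    fun h1 h2 _ _ h3 h4 => C.eq_of_singletons hV h1 h2 h3 h4
  have hcard : (Finset.univ : Finset V).card = Fintype.card V := Finset.card_univ
  choose p hp hp1 hp2 using C.exists_repairing_vertex Finset.univ (Finset.card_pos.1 (by omega))
    (fun x _ y _ h => hne h) (fun v _ x _ y _ h1 h2 i k h3 h4 => hsing h1 h2 h3 h4)
  set P : Finset V := Finset.univ.image p with hP
  have hpP : ∀ i, p i ∈ P := fun i => Finset.mem_image_of_mem _ (Finset.mem_univ i)
  have hPU : ∀ {x}, x ∈ Pᶜ → ∀ i, x ≠ p i := by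
    rintro x hx i rfl
    exact Finset.mem_compl.1 hx (hpP i)
  obtain ⟨τ, hτ⟩ := C.exists_type_map Pᶜ p (fun i h => Finset.mem_compl.1 h (hpP i))
    (fun x _ y _ h => hne h)
    (fun x hx y hy hxy i h => hp2 i x (Finset.mem_univ x) y (Finset.mem_univ y) (hPU hx i)
      (hPU hy i) hxy h)
    (by
      intro x _ y _ hxy i k hi hk hik
      have hne' : i ≠ k := by
        rintro rfl
        exact C.disj (c := i) (u := y) (v := x) (by simp [hi]) (by simp [hk])
      -- Each `p i` was chosen with a singleton `{i}` at it if there is any, so `p i = p k` would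
      -- put two different singletons at one vertex.
      rcases hp1 i with ⟨z, -, hz, hzS⟩ | h
      · rcases hp1 k with ⟨z', -, hz', hzS'⟩ | h'
        · rw [← hik] at hz' hzS'
          exact hne' (hsing hz hz' hzS hzS')
        · exact h' y (Finset.mem_univ _) x (Finset.mem_univ _) hxy.symm hk
      · exact h x (Finset.mem_univ _) y (Finset.mem_univ _) hxy hi)
  have hinj : Set.InjOn τ (Pᶜ : Finset V) := by
    intro x hx y hy hxy
    by_contra h
    obtain ⟨j, hj, -⟩ := hτ x hx y hy h
    exact hj (congrFun hxy j)
  have h1 := Finset.card_le_card_of_injOn τ (t := Finset.univ) (fun _ _ => Finset.mem_univ _) hinj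
  have h2 : P.card ≤ 4 := by simpa using Finset.card_image_le (s := Finset.univ) (f := p)
  rw [Finset.card_compl, Finset.card_univ, Fintype.card_fun, Fintype.card_bool,
    Fintype.card_fin] at h1
  omega

/-! ### From matroids to covers -/

/-- The pattern of four relations on the edges of a complete graph that behave like parallelism in
matroids in which all matchings are independent. -/
noncomputable def ofRel {V : Type*} (R : Fin 4 → Sym2 V → Sym2 V → Prop)
    (symm : ∀ {c e f}, R c e f → R c f e)
    (trans : ∀ {c e f g}, ¬ e.IsDiag → ¬ f.IsDiag → ¬ g.IsDiag → R c e f → R c f g → R c e g)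
    (meet : ∀ {c e f}, ¬ e.IsDiag → ¬ f.IsDiag → R c e f → ∃ x, x ∈ e ∧ x ∈ f)
    (cover : ∀ {u v w : V}, u ≠ v → w ≠ v → u ≠ w → ∃ c, R c s(u, v) s(w, v)) :
    StarTriangleCover V where
  tri c u v w := u ≠ v ∧ v ≠ w ∧ u ≠ w ∧ R c s(u, v) s(v, w) ∧ R c s(v, w) s(u, w)
  -- A class with a single edge counts neither as a star nor as a triangle.
  S u v := by
    classical
    exact {c | u ≠ v ∧ (∃ w, w ≠ u ∧ w ≠ v ∧ R c s(u, v) s(w, v)) ∧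
      ∀ w, v ≠ w → u ≠ w → R c s(u, v) s(v, w) → ¬ R c s(v, w) s(u, w)}
  disj := by
    classical
    intro c u v h h'
    simp only [Finset.mem_filter, Finset.mem_univ, true_and] at h h'
    obtain ⟨huv, ⟨w, hwu, hwv, hw⟩, hno⟩ := h
    obtain ⟨-, ⟨x, hxv, hxu, hx⟩, -⟩ := h'
    rw [Sym2.eq_swap] at hx
    -- A class with further edges at both ends of `uv` is a triangle, since `wv` and `xu` meet only
    -- if `w = x`.
    have h1 : R c s(w, v) s(x, u) :=
      trans (by simpa using hwv) (by simpa using huv) (by simpa using hxu) (symm hw) hx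
    obtain ⟨y, hy, hy'⟩ := meet (by simpa using hwv) (by simpa using hxu) h1
    have hwx : w = x := by
      rw [Sym2.mem_iff] at hy hy'
      rcases hy with rfl | rfl <;> rcases hy' with rfl | rfl
      · rfl
      · exact absurd rfl hwu
      · exact absurd rfl hxv
      · exact absurd rfl huv
    subst hwx
    have e1 : s(w, v) = s(v, w) := Sym2.eq_swap
    have e2 : s(w, u) = s(u, w) := Sym2.eq_swap
    rw [e1] at hw h1
    rw [e2] at h1
    exact hno w hwv.symm hwu.symm hw h1
  tri_swap := by
    rintro c u v w ⟨h1, h2, h3, h4, h5⟩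
    refine ⟨h1.symm, h3, h2, ?_, symm h5⟩
    rw [Sym2.eq_swap]
    exact trans (by simpa using h1) (by simpa using h2) (by simpa using h3) h4 h5
  tri_rot := by
    rintro c u v w ⟨h1, h2, h3, h4, h5⟩
    have e1 : s(w, u) = s(u, w) := Sym2.eq_swap
    have e2 : s(v, u) = s(u, v) := Sym2.eq_swap
    refine ⟨h2, h3.symm, h1.symm, e1 ▸ h5, ?_⟩
    rw [e1, e2]
    exact symm (trans (by simpa using h1) (by simpa using h2) (by simpa using h3) h4 h5)
  tri_notMem := by
    classical
    rintro c u v w ⟨h1, h2, h3, h4, h5⟩ h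
    simp only [Finset.mem_filter, Finset.mem_univ, true_and] at h
    exact h.2.2 w h2 h3 h4 h5
  tri_unique := by
    rintro c u v w w' ⟨h1, h2, h3, h4, h5⟩ ⟨-, k2, k3, k4, k5⟩
    have h6 : R c s(v, w) s(u, w') :=
      trans (by simpa using h2) (by simpa using k2) (by simpa using k3)
        (trans (by simpa using h2) (by simpa using h1) (by simpa using k2) (symm h4) k4) k5
    obtain ⟨y, hy, hy'⟩ := meet (by simpa using h2) (by simpa using k3) h6
    rw [Sym2.mem_iff] at hy hy'
    rcases hy with rfl | rfl <;> rcases hy' with rfl | rfl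
    · exact absurd rfl h1
    · exact absurd rfl k2
    · exact absurd rfl h3
    · rfl
  cover := by
    classical
    intro u v w huv hwv huw
    obtain ⟨c, hc⟩ := cover huv hwv huw
    by_cases ht : R c s(v, w) s(u, w)
    · have e : s(w, v) = s(v, w) := Sym2.eq_swap
      exact Or.inr ⟨c, huv, hwv.symm, huw, e ▸ hc, ht⟩
    left
    have key : ∀ {u w : V}, u ≠ v → w ≠ v → u ≠ w → R c s(u, v) s(w, v) →
        ¬ R c s(v, w) s(u, w) →
        (∃ x, x ≠ u ∧ x ≠ v ∧ R c s(u, v) s(x, v)) ∧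
        ∀ x, v ≠ x → u ≠ x → R c s(u, v) s(v, x) → ¬ R c s(v, x) s(u, x) := by
      intro u w huv hwv huw hc ht
      refine ⟨⟨w, huw.symm, hwv, hc⟩, fun x hvx hux h1 h2 => ?_⟩
      have h3 : R c s(w, v) s(u, x) :=
        trans (by simpa using hwv) (by simpa using hvx) (by simpa using hux)
          (trans (by simpa using hwv) (by simpa using huv) (by simpa using hvx) (symm hc) h1) h2
      obtain ⟨y, hy, hy'⟩ := meet (by simpa using hwv) (by simpa using hux) h3
      rw [Sym2.mem_iff] at hy hy'
      have hwx : w = x := by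
        rcases hy with rfl | rfl <;> rcases hy' with rfl | rfl
        · exact absurd rfl huw
        · rfl
        · exact absurd rfl huv
        · exact absurd rfl hvx
      exact ht (hwx ▸ h2)
    have ht' : ¬ R c s(v, u) s(w, u) := by
      intro h
      apply ht
      have e1 : s(v, u) = s(u, v) := Sym2.eq_swap
      have e2 : s(w, u) = s(u, w) := Sym2.eq_swap
      have e3 : s(w, v) = s(v, w) := Sym2.eq_swap
      rw [e1, e2] at h
      rw [e3] at hc
      exact trans (by simpa using hwv.symm) (by simpa using huv) (by simpa using huw) (symm hc) h
    refine ⟨c, ?_, ?_⟩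
    · simp only [Finset.mem_filter, Finset.mem_univ, true_and]
      exact ⟨huv, key huv hwv huw hc ht⟩
    · simp only [Finset.mem_filter, Finset.mem_univ, true_and]
      exact ⟨hwv, key hwv huv huw.symm (symm hc) ht'⟩

end StarTriangleCover

/-- The matchings of a complete graph with at least 13 vertices are not the intersection of four
or fewer matroids. -/
theorem not_isMatroidIntersection_top {V : Type*} [Fintype V] (hV : 13 ≤ Fintype.card V) {m : ℕ}
    (hm : m ≤ 4) :
    ¬ IsMatroidIntersection (⊤ : SimpleGraph V).edgeSet (matchings ⊤) m := by
  rintro ⟨M, -, hM⟩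
  have hedge : ∀ {e : Sym2 V}, e ∈ (⊤ : SimpleGraph V).edgeSet ↔ ¬ e.IsDiag := by simp
  have hmem : ∀ {J : Set (Sym2 V)}, J ∈ matchings (⊤ : SimpleGraph V) ↔
      J ⊆ (⊤ : SimpleGraph V).edgeSet ∧ ∀ a, (M a).Indep J := by
    intro J
    rw [hM]
    rfl
  have hindep : ∀ {e f : Sym2 V}, ¬ e.IsDiag → ¬ f.IsDiag → (e ≠ f → ∀ x, x ∈ e → x ∉ f) →
      ∀ a, (M a).Indep {e, f} := by
    intro e f he hf h
    refine (hmem.1 ⟨?_, ?_⟩).2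
    · rintro g (rfl | rfl)
      exacts [hedge.2 he, hedge.2 hf]
    · rintro g (rfl | rfl) g' (rfl | rfl) hne x hx hx'
      · exact hne rfl
      · exact h hne x hx hx'
      · exact h hne.symm x hx' hx
      · exact hne rfl
  have hsingle : ∀ {e : Sym2 V}, ¬ e.IsDiag → ∀ a, (M a).Indep {e} := by
    intro e he a
    have := hindep he he (fun h => absurd rfl h) a
    rwa [Set.pair_eq_singleton] at this
  let C : StarTriangleCover V := StarTriangleCover.ofRel
    -- If `m < 4`, the missing partitions consist of single edges.
    (fun c e f => e = f ∨ ∃ h : c.1 < m, ¬ (M ⟨c.1, h⟩).Indep {e, f})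
    (by
      rintro c e f (rfl | ⟨h, h'⟩)
      · exact Or.inl rfl
      · exact Or.inr ⟨h, by rwa [Set.pair_comm]⟩)
    (by
      rintro c e f g - hf - (rfl | ⟨h, h'⟩) (rfl | ⟨h, k⟩)
      · exact Or.inl rfl
      · exact Or.inr ⟨h, k⟩
      · exact Or.inr ⟨h, h'⟩
      · by_cases heg : e = g
        · exact Or.inl heg
        · refine Or.inr ⟨h, fun hI => ?_⟩
          -- Transitivity of parallelism: if `{e, g}` were independent, one of its elements would
          -- extend the independent set `{f}`.
          obtain ⟨x, ⟨hx, -⟩, hx'⟩ := (hsingle hf ⟨c.1, h⟩).augment hI (by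
            rw [Set.encard_singleton, Set.encard_pair heg]
            norm_num)
          rcases hx with rfl | rfl
          · exact h' hx'
          · exact k (by rwa [Set.pair_comm]))
    (by
      rintro c e f he hf (rfl | ⟨h, h'⟩)
      · exact ⟨_, Sym2.out_fst_mem e, Sym2.out_fst_mem e⟩
      · by_contra hcon
        push Not at hcon
        exact h' (hindep he hf (fun _ => hcon) _))
    (by
      intro u v w huv hwv huw
      by_contra hcon
      push Not at hcon
      have hJ : ({s(u, v), s(w, v)} : Set (Sym2 V)) ∈ matchings (⊤ : SimpleGraph V) := by
        refine hmem.2 ⟨?_, fun a => (hcon ⟨a.1, a.2.trans_le hm⟩).2 a.2⟩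
        rintro g (rfl | rfl)
        exacts [hedge.2 (by simpa using huv), hedge.2 (by simpa using hwv)]
      exact hJ.2 _ (Or.inl rfl) _ (Or.inr rfl) (hcon 0).1 v (Sym2.mem_mk_right u v)
        (Sym2.mem_mk_right w v))
  exact absurd C.card_lt_thirteen (not_lt.2 hV)

/-! ### Upper bound by linear orders -/

/-- Linear orders such that any vertex lies above any two others in one of them give partition
matroids whose intersection are the matchings: the edges are partitioned by their upper ends. -/
theorem isMatroidIntersection_of_ranks {V β : Type*} [LinearOrder β] (G : SimpleGraph V) {m : ℕ}
    (r : Fin m → V → β) (hr : ∀ c, Function.Injective (r c))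
    (h : ∀ u v w, u ≠ v → w ≠ v → ∃ c, r c u < r c v ∧ r c w < r c v) :
    IsMatroidIntersection G.edgeSet (matchings G) m := by
  have htop : ∀ c (e : Sym2 V), ∃ x ∈ e, r c x = (e.map (r c)).sup := by
    intro c e
    induction e using Sym2.ind with
    | _ u v =>
      rcases le_total (r c u) (r c v) with huv | huv
      · exact ⟨v, Sym2.mem_mk_right u v, by simp [huv]⟩
      · exact ⟨u, Sym2.mem_mk_left u v, by simp [huv]⟩
  -- Pulling back the free matroid along the rank of the upper end allows one edge for each upper
  -- end.
  refine ⟨fun c => ((Matroid.freeOn Set.univ).comap fun e => (e.map (r c)).sup).restrict G.edgeSet,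
    fun c => rfl, ?_⟩
  ext J
  simp only [Set.mem_ofPred_eq, Matroid.restrict_indep_iff, Matroid.comap_indep_iff,
    Matroid.freeOn_indep_iff, Set.subset_univ, true_and]
  constructor
  · rintro ⟨hJ, hJ'⟩
    refine ⟨hJ, fun c => ⟨fun e he f hf hef => ?_, hJ⟩⟩
    by_contra hne
    obtain ⟨x, hx, hxe⟩ := htop c e
    obtain ⟨y, hy, hyf⟩ := htop c f
    have hxy : x = y := hr c (hxe.trans (hef.trans hyf.symm))
    exact hJ' e he f hf hne x hx (hxy ▸ hy)
  · rintro ⟨hJ, hJ'⟩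
    refine ⟨hJ, fun e he f hf hne v hve hvf => ?_⟩
    obtain ⟨u, rfl⟩ := Sym2.mem_iff_exists.1 hve
    obtain ⟨w, rfl⟩ := Sym2.mem_iff_exists.1 hvf
    have hu : u ≠ v := ((SimpleGraph.mem_edgeSet G).1 (hJ he)).ne'
    have hw : w ≠ v := ((SimpleGraph.mem_edgeSet G).1 (hJ hf)).ne'
    obtain ⟨c, hc, hc'⟩ := h u v w hu hw
    refine hne ((hJ' c).1 he hf ?_)
    simp [hc.le, hc'.le]

/-- Five linear orders on 15 points, given by the ranks of the points. -/
def fiveOrders : Fin 5 → Fin 15 → Fin 15 :=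
  ![![0, 1, 2, 3, 4, 5, 6, 7, 8, 9, 10, 11, 12, 13, 14],
    ![11, 3, 9, 10, 7, 14, 12, 6, 8, 4, 1, 5, 2, 13, 0],
    ![8, 3, 6, 7, 5, 1, 4, 10, 9, 12, 14, 11, 13, 2, 0],
    ![10, 7, 13, 12, 14, 4, 6, 1, 2, 8, 3, 9, 5, 0, 11],
    ![2, 14, 5, 4, 3, 9, 10, 12, 11, 7, 1, 6, 0, 8, 13]]

set_option maxRecDepth 100000 in
theorem fiveOrders_injective : ∀ c x y, fiveOrders c x = fiveOrders c y → x = y := by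
  decide +kernel

set_option maxRecDepth 100000 in
theorem fiveOrders_suitable : ∀ u v w : Fin 15, u ≠ v → w ≠ v →
    ∃ c, fiveOrders c u < fiveOrders c v ∧ fiveOrders c w < fiveOrders c v := by
  decide +kernel

theorem muGraph_le_five {V : Type*} [Finite V] (G : SimpleGraph V) (hV : Nat.card V ≤ 15) :
    muGraph G ≤ 5 := by
  let φ : V → Fin 15 := fun x => Fin.castLE hV (Finite.equivFin V x)
  have hφ : Function.Injective φ :=
    (Fin.castLE_injective hV).comp (Finite.equivFin V).injective
  have h : IsMatroidIntersection G.edgeSet (matchings G) 5 :=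
    isMatroidIntersection_of_ranks G (fun c x => fiveOrders c (φ x))
      (fun c x y hxy => hφ (fiveOrders_injective c _ _ hxy))
      (fun u v w hu hw => fiveOrders_suitable _ _ _ (hφ.ne hu) (hφ.ne hw))
  exact iInf₂_le (5 : ℕ) h

/-! ### The values of `mu` -/

theorem five_le_muGraph_top {V : Type*} [Fintype V] (hV : 13 ≤ Fintype.card V) :
    5 ≤ muGraph (⊤ : SimpleGraph V) := by
  refine le_iInf₂ fun m hm => ?_
  by_contra hlt
  rw [not_le] at hlt
  have : m < 5 := by exact_mod_cast hlt
  exact not_isMatroidIntersection_top hV (by omega) hm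

theorem mu_eq_five {n : ℕ} (h13 : 13 ≤ n) (h15 : n ≤ 15) : mu n = 5 := by
  apply le_antisymm
  · refine sSup_le ?_
    rintro k ⟨V, _, G, hV, rfl⟩
    exact muGraph_le_five G (hV.trans h15)
  · exact (five_le_muGraph_top (V := Fin 13) (by simp)).trans
      (le_sSup ⟨Fin 13, inferInstance, ⊤, by simpa using h13, rfl⟩)

theorem theorem8 : mu 13 = 5 ∧ mu 14 = 5 ∧ mu 15 = 5 :=
  ⟨mu_eq_five le_rfl (by norm_num), mu_eq_five (by norm_num) (by norm_num),
    mu_eq_five (by norm_num) le_rfl⟩
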